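/- A rooted planar map is a finite connected graph (loops and multiple edges allowed) with at least one edge, embedded in the sphere and carrying a marked oriented edge, its root; maps are considered up to root-preserving, orientation-preserving homeomorphism. It is a $q$-angulation if all its faces have degree $q$. A plane tree is a map with a single face; a planted plane tree is a rooted one. Fix integers $e \ge 0$ and $m \ge 1$. An $m$-tree-decorated map with $e+m$ edges is a pair $(\mathfrak m,\mathfrak t)$, where $\mathfrak m$ is a rooted planar map with $e+m$ edges and $\mathfrak t$ is a submap of $\mathfrak m$ (obtained by suppressing edges and vertices, keeping the cyclic order around each vertex) that is a plane tree with $m$ edges. (a) Let $(\mathfrak m,\mathfrak t)$ be chosen uniformly at random among the (finitely many, at least one) $m$-tree-decorated maps with $e+m$ edges whose root edge lies on the tree. Then $\mathfrak t$, rooted at the root edge of $\mathfrak m$, is uniformly distributed on the set of planted plane trees with $m$ edges. (b) Let $(\mathfrak m,\mathfrak t)$ be chosen uniformly at random among all $m$-tree-decorated maps with $e+m$ edges, the root edge being any oriented edge of $\mathfrak m$. Then the unrooted plane tree $\mathfrak t$ has the law of a uniformly random planted plane tree with $m$ edges whose root has been forgotten. For every $q$, both (a) and (b) also hold with "map" replaced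 by "$q$-angulation", whenever such tree-decorated $q$-angulations with $e+m$ edges exist. -/

import Mathlib

/-! Planar maps are encoded by rotation systems: the elements of `D` are the oriented edges
("darts"), `σ` sends a dart to the next dart counterclockwise around its starting vertex, and
`α` reverses a dart.  Vertices, edges and faces are the cycles of `σ`, `α` and `σ⁻¹ * α`. -/

/-- Number of cycles of a permutation, fixed points included. -/
noncomputable def numCycles {D : Type} (f : Equiv.Perm D) : ℕ :=
  Nat.card (Quotient (Equiv.Perm.SameCycle.setoid f))

/-- A planar map (connected graph with at least one edge, loops and multiple edges allowed,
embedded in the sphere) with set of oriented edges `D`.  The field `euler` is Euler's formula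
`V + F = E + 2`, which says that the surface is the sphere. -/
@[ext] structure PlanarMap (D : Type) where
  σ : Equiv.Perm D
  α : Equiv.Perm D
  α_invol : ∀ d, α (α d) = d
  α_ne : ∀ d, α d ≠ d
  connected : ∀ d d', ∃ g ∈ Subgroup.closure {σ, α}, g d = d'
  euler : numCycles σ + numCycles (σ⁻¹ * α) = numCycles α + 2

namespace PlanarMap

variable {D D' D'' : Type}

/-- The face permutation: `M.face d` is the oriented edge that follows `d` when one walks along
the face lying to the left of `d`. -/
def face (M : PlanarMap D) : Equiv.Perm D := M.σ⁻¹ * M.α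

/-- The degree of the face to the left of `d`: the number of oriented edges that have this face
on their left. -/
noncomputable def faceDegree (M : PlanarMap D) (d : D) : ℕ :=
  Nat.card {d' : D // M.face.SameCycle d d'}

/-- Every face has degree `q`. -/
def IsAngulation (q : ℕ) (M : PlanarMap D) : Prop := ∀ d, M.faceDegree d = q

/-- A (plane) tree is a map with a single face. -/
def IsTree (M : PlanarMap D) : Prop := numCycles M.face = 1

/-- The relabelling `e` of oriented edges is an orientation-preserving isomorphism. -/
structure IsIso (M : PlanarMap D) (N : PlanarMap D') (e : D ≃ D') : Prop where
  map_σ : ∀ d, e (M.σ d) = N.σ (e d)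
  map_α : ∀ d, e (M.α d) = N.α (e d)

theorem IsIso.refl (M : PlanarMap D) : IsIso M M (Equiv.refl D) :=
  ⟨fun _ => rfl, fun _ => rfl⟩

theorem IsIso.symm {M : PlanarMap D} {N : PlanarMap D'} {e : D ≃ D'} (h : IsIso M N e) :
    IsIso N M e.symm :=
  ⟨fun d => by rw [Equiv.symm_apply_eq, h.map_σ, Equiv.apply_symm_apply],
   fun d => by rw [Equiv.symm_apply_eq, h.map_α, Equiv.apply_symm_apply]⟩

theorem IsIso.trans {M : PlanarMap D} {N : PlanarMap D'} {P : PlanarMap D''} {e : D ≃ D'}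
    {e' : D' ≃ D''} (h : IsIso M N e) (h' : IsIso N P e') : IsIso M P (e.trans e') :=
  ⟨fun d => by simp [h.map_σ, h'.map_σ], fun d => by simp [h.map_α, h'.map_α]⟩

theorem IsIso.map_face {M : PlanarMap D} {N : PlanarMap D'} {e : D ≃ D'} (h : IsIso M N e)
    (d : D) : e (M.face d) = N.face (e d) := by
  have key := h.map_σ (M.σ.symm (M.α d))
  rw [Equiv.apply_symm_apply, h.map_α] at key
  change e (M.σ.symm (M.α d)) = N.σ.symm (N.α (e d))
  rw [key, Equiv.symm_apply_apply]

theorem IsIso.sameCycle {M : PlanarMap D} {N : PlanarMap D'} {e : D ≃ D'} (h : IsIso M N e)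
    {d d' : D} (hd : M.face.SameCycle d d') : N.face.SameCycle (e d) (e d') := by
  have hconj : N.face = e.permCongr M.face := by
    ext x
    simp [Equiv.permCongr_apply, h.map_face]
  obtain ⟨i, rfl⟩ := hd
  refine ⟨i, ?_⟩
  have : e.permCongr M.face ^ i = e.permCongr (M.face ^ i) :=
    (map_zpow e.permCongrHom M.face i).symm
  rw [hconj, this]
  simp [Equiv.permCongr_apply]

theorem IsIso.isAngulation {M : PlanarMap D} {N : PlanarMap D'} {e : D ≃ D'} (h : IsIso M N e)
    {q : ℕ} (hM : M.IsAngulation q) : N.IsAngulation q := by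
  intro d
  rw [← hM (e.symm d)]
  refine Nat.card_congr (Equiv.subtypeEquiv e.symm fun d' => ⟨h.symm.sameCycle, fun hd => ?_⟩)
  simpa using h.sameCycle hd

/-- `N` is the submap of `M` carried by the oriented edges in the range of `f`: the suppression
of the other edges (and of the vertices left isolated) keeps reversal and the cyclic order at
every vertex.  Hence the successor of `d` in `N` is the first oriented edge, among
the strict iterated successors of `f d` in `M`, that has been kept. -/
structure IsSubmap (N : PlanarMap D') (M : PlanarMap D) (f : D' ↪ D) : Prop where
  map_α : ∀ d, f (N.α d) = M.α (f d)
  map_σ : ∀ d, ∃ k : ℕ, 0 < k ∧ (M.σ ^ k) (f d) = f (N.σ d) ∧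
    ∀ j : ℕ, 0 < j → j < k → (M.σ ^ j) (f d) ∉ Set.range f

end PlanarMap

/-! ### Plane trees with `m` edges, that is, with `2 m` oriented edges -/

/-- Plane trees with labelled oriented edges. -/
abbrev LabelledTree (m : ℕ) : Type := {t : PlanarMap (Fin (2 * m)) // t.IsTree}

/-- Isomorphism of plane trees. -/
def planeTreeSetoid (m : ℕ) : Setoid (LabelledTree m) where
  r t t' := ∃ b, t.1.IsIso t'.1 b
  iseqv := ⟨fun t => ⟨_, .refl t.1⟩, fun ⟨_, h⟩ => ⟨_, h.symm⟩,
    fun ⟨_, h⟩ ⟨_, h'⟩ => ⟨_, h.trans h'⟩⟩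

/-- Isomorphism of plane trees with a root edge, i.e. a marked oriented edge. -/
def plantedTreeSetoid (m : ℕ) : Setoid (LabelledTree m × Fin (2 * m)) where
  r t t' := ∃ b, t.1.1.IsIso t'.1.1 b ∧ b t.2 = t'.2
  iseqv := ⟨fun t => ⟨_, .refl t.1.1, rfl⟩,
    fun ⟨_, h, hr⟩ => ⟨_, h.symm, by rw [← hr, Equiv.symm_apply_apply]⟩,
    fun ⟨_, h, hr⟩ ⟨_, h', hr'⟩ => ⟨_, h.trans h', by simp [hr, hr']⟩⟩

/-- Unrooted plane trees with `m` edges. -/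
def PlaneTree (m : ℕ) : Type := Quotient (planeTreeSetoid m)

/-- Planted (that is, rooted) plane trees with `m` edges. -/
def PlantedTree (m : ℕ) : Type := Quotient (plantedTreeSetoid m)

/-- Forget the root edge. -/
def PlantedTree.forgetRoot {m : ℕ} : PlantedTree m → PlaneTree m :=
  Quotient.map' (s₁ := plantedTreeSetoid m) (s₂ := planeTreeSetoid m) Prod.fst
    fun _ _ ⟨b, h, _⟩ => ⟨b, h⟩

/-! ### Tree-decorated maps with `e + m` edges and a tree with `m` edges -/

/-- A planar map with `e + m` (labelled) edges, together with a submap that is a tree with `m`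
edges; no root has been chosen yet. -/
structure Decoration (e m : ℕ) where
  map : PlanarMap (Fin (2 * (e + m)))
  tree : LabelledTree m
  emb : Fin (2 * m) ↪ Fin (2 * (e + m))
  isSubmap : tree.1.IsSubmap map emb

/-- `a` (on the map) and `b` (on the tree) form an isomorphism of decorated maps: `a` is an
isomorphism of maps that carries the first tree onto the second one, through `b`. -/
structure Decoration.IsIso {e m : ℕ} (x y : Decoration e m)
    (a : Fin (2 * (e + m)) ≃ Fin (2 * (e + m))) (b : Fin (2 * m) ≃ Fin (2 * m)) : Prop where
  map : x.map.IsIso y.map a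
  tree : x.tree.1.IsIso y.tree.1 b
  emb : ∀ d, a (x.emb d) = y.emb (b d)

namespace Decoration.IsIso

variable {e m : ℕ} {x y z : Decoration e m}
  {a a' : Fin (2 * (e + m)) ≃ Fin (2 * (e + m))} {b b' : Fin (2 * m) ≃ Fin (2 * m)}

theorem refl (x : Decoration e m) : x.IsIso x (Equiv.refl _) (Equiv.refl _) :=
  ⟨.refl _, .refl _, fun _ => rfl⟩

theorem symm (h : x.IsIso y a b) : y.IsIso x a.symm b.symm :=
  ⟨h.map.symm, h.tree.symm, fun d => by rw [Equiv.symm_apply_eq, h.emb, Equiv.apply_symm_apply]⟩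

theorem trans (h : x.IsIso y a b) (h' : y.IsIso z a' b') :
    x.IsIso z (a.trans a') (b.trans b') :=
  ⟨h.map.trans h'.map, h.tree.trans h'.tree, fun d => by simp [h.emb, h'.emb]⟩

end Decoration.IsIso

/-- Isomorphism of decorated maps whose root edge is any oriented edge of the map. -/
def treeDecoratedSetoid (e m : ℕ) : Setoid (Decoration e m × Fin (2 * (e + m))) where
  r x y := ∃ a b, x.1.IsIso y.1 a b ∧ a x.2 = y.2
  iseqv := ⟨fun x => ⟨_, _, .refl x.1, rfl⟩,
    fun ⟨_, _, h, hr⟩ => ⟨_, _, h.symm, by rw [← hr, Equiv.symm_apply_apply]⟩,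
    fun ⟨_, _, h, hr⟩ ⟨_, _, h', hr'⟩ => ⟨_, _, h.trans h', by simp [hr, hr']⟩⟩

/-- Isomorphism of decorated maps whose root edge is an oriented edge `s` of the tree; as
an oriented edge of the map, the root edge is `emb s`. -/
def rootedOnTreeSetoid (e m : ℕ) : Setoid (Decoration e m × Fin (2 * m)) where
  r x y := ∃ a b, x.1.IsIso y.1 a b ∧ b x.2 = y.2
  iseqv := ⟨fun x => ⟨_, _, .refl x.1, rfl⟩,
    fun ⟨_, _, h, hr⟩ => ⟨_, _, h.symm, by rw [← hr, Equiv.symm_apply_apply]⟩,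
    fun ⟨_, _, h, hr⟩ ⟨_, _, h', hr'⟩ => ⟨_, _, h.trans h', by simp [hr, hr']⟩⟩

/-- Tree-decorated maps: rooted maps with `e + m` edges, the root edge being any oriented edge
of the map, with a submap that is an (unrooted) tree with `m` edges. -/
def TreeDecoratedMap (e m : ℕ) : Type := Quotient (treeDecoratedSetoid e m)

/-- Tree-decorated maps with `e + m` edges and a tree with `m` edges whose root edge lies on
the tree. -/
def RootedOnTree (e m : ℕ) : Type := Quotient (rootedOnTreeSetoid e m)

namespace TreeDecoratedMap

/-- The decorating tree (unrooted). -/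
def tree {e m : ℕ} : TreeDecoratedMap e m → PlaneTree m :=
  Quotient.map' (s₁ := treeDecoratedSetoid e m) (s₂ := planeTreeSetoid m) (fun x => x.1.tree)
    fun _ _ ⟨_, b, h, _⟩ => ⟨b, h.tree⟩

/-- The underlying map is a `q`-angulation. -/
def IsAngulation {e m : ℕ} (q : ℕ) : TreeDecoratedMap e m → Prop :=
  Quotient.lift (s := treeDecoratedSetoid e m) (fun x => x.1.map.IsAngulation q)
    fun _ _ ⟨_, _, h, _⟩ => propext ⟨h.map.isAngulation, h.map.symm.isAngulation⟩

end TreeDecoratedMap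

namespace RootedOnTree

/-- The decorating tree, rooted at the root edge of the map. -/
def tree {e m : ℕ} : RootedOnTree e m → PlantedTree m :=
  Quotient.map' (s₁ := rootedOnTreeSetoid e m) (s₂ := plantedTreeSetoid m)
    (fun x => (x.1.tree, x.2)) fun _ _ ⟨_, b, h, hr⟩ => ⟨b, h.tree, hr⟩

/-- The underlying map is a `q`-angulation. -/
def IsAngulation {e m : ℕ} (q : ℕ) : RootedOnTree e m → Prop :=
  Quotient.lift (s := rootedOnTreeSetoid e m) (fun x => x.1.map.IsAngulation q)
    fun _ _ ⟨_, _, h, _⟩ => propext ⟨h.map.isAngulation, h.map.symm.isAngulation⟩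

end RootedOnTree

/-! ### Finiteness, and the discrete σ-algebras -/

instance {D : Type} [Finite D] : Finite (PlanarMap D) :=
  Finite.of_injective (fun M : PlanarMap D => (M.σ, M.α)) fun M N h => by
    simp only [Prod.mk.injEq] at h
    exact PlanarMap.ext h.1 h.2

instance (e m : ℕ) : Finite (Decoration e m) :=
  Finite.of_injective (fun x : Decoration e m => (x.map, x.tree, x.emb)) fun x y h => by
    cases x; cases y; simp_all

instance (m : ℕ) : Finite (PlaneTree m) :=
  inferInstanceAs (Finite (Quotient (planeTreeSetoid m)))

instance (m : ℕ) : Finite (PlantedTree m) :=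
  inferInstanceAs (Finite (Quotient (plantedTreeSetoid m)))

instance (e m : ℕ) : Finite (TreeDecoratedMap e m) :=
  inferInstanceAs (Finite (Quotient (treeDecoratedSetoid e m)))

instance (e m : ℕ) : Finite (RootedOnTree e m) :=
  inferInstanceAs (Finite (Quotient (rootedOnTreeSetoid e m)))

instance (m : ℕ) : MeasurableSpace (PlaneTree m) := ⊤

instance (m : ℕ) : MeasurableSpace (PlantedTree m) := ⊤

instance (e m : ℕ) : MeasurableSpace (TreeDecoratedMap e m) := ⊤

instance (e m : ℕ) : MeasurableSpace (RootedOnTree e m) := ⊤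

/-! ### Classes of constant size -/

/-! The number of maps decorated by a given labelled tree does not depend on the tree. Since a tree
has a single face, its face permutation is one cycle through all its oriented edges, so two trees
with `m` edges can be labelled to have the same contour. Cutting a map along `t` leaves a boundary
that can be closed again along any `t'` with this contour.

Algebraically, `σ` and `α` of the map are both multiplied on the left by the same permutation β,
which is `t'.α * t.α` on the tree and the identity elsewhere. The face permutation `σ⁻¹ * α` is
untouched, so any condition on the faces survives; this is why angulations need no separate
argument. `reglue` checks that the result is a planar map, `isSubmap_reglue` that it contains `t'`,
and `exists_card_decoration_eq` draws the conclusion.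

Passing to isomorphism classes is harmless because an isomorphism is determined by the image of one
oriented edge: rooted objects have no nontrivial automorphism, and every class has the same number
of labellings. The fibres over trees are thus proportional to those on the planted side, and
`map_uniformOn_eq_map_uniformOn` turns this into equality of laws. -/

theorem card_mem_quotient_eq_mul {X : Type*} [Finite X] (S : Setoid X) (K : ℕ)
    (h : ∀ x, Nat.card {y // S x y} = K) (B : Set (Quotient S)) :
    Nat.card {x // (Quotient.mk S x) ∈ B} = K * B.ncard := by
  classical
  have : Fintype B := Fintype.ofFinite _
  let E : {x // (Quotient.mk S x) ∈ B} ≃ Σ b : B, {x // Quotient.mk S x = b.1} :=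
    { toFun := fun x => ⟨⟨_, x.2⟩, x.1, rfl⟩
      invFun := fun y => ⟨y.2.1, by rw [y.2.2]; exact y.1.2⟩
      left_inv := fun x => rfl
      right_inv := fun ⟨⟨b, hb⟩, ⟨x, hx⟩⟩ => by
        obtain rfl : Quotient.mk S x = b := hx
        rfl }
  have key (b : B) : Nat.card {x // Quotient.mk S x = b.1} = K := by
    obtain ⟨b, hb⟩ := b
    induction b using Quotient.inductionOn with
    | h x =>
      rw [← h x]
      refine Nat.card_congr (Equiv.subtypeEquivRight fun y => ?_)
      exact Quotient.eq.trans ⟨fun h => S.symm h, fun h => S.symm h⟩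
  rw [Nat.card_congr E, Nat.card_sigma, Finset.sum_congr rfl fun b _ => key b, Finset.sum_const,
    Finset.card_univ, ← Nat.card_eq_fintype_card, Nat.card_coe_set_eq, smul_eq_mul, mul_comm]

theorem card_eq_mul_card_quotient {X : Type*} [Finite X] (S : Setoid X) (K : ℕ)
    (h : ∀ x, Nat.card {y // S x y} = K) : Nat.card X = K * Nat.card (Quotient S) := by
  rw [← Set.ncard_univ (Quotient S), ← card_mem_quotient_eq_mul S K h]
  exact Nat.card_congr (Equiv.subtypeUnivEquiv fun _ => Set.mem_univ _).symm

/-! ### Numbers of cycles -/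

section Cycles

variable {D D' T : Type}

theorem Equiv.Perm.SameCycle.apply_eq {Z : Type*} {f : Equiv.Perm D} {g : D → Z}
    (hg : ∀ x, g (f x) = g x) {x y : D} (h : f.SameCycle x y) : g x = g y := by
  have hpow (n : ℕ) (z : D) : g ((f ^ n) z) = g z := by
    induction n with
    | zero => rfl
    | succ n ih => rw [pow_succ', Equiv.Perm.mul_apply, hg, ih]
  obtain ⟨i, rfl⟩ := h
  obtain ⟨n, rfl | rfl⟩ := i.eq_nat_or_neg
  · rw [zpow_natCast, hpow]
  · rw [← hpow n ((f ^ (-(n : ℤ))) x), zpow_neg, zpow_natCast,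
      ← Equiv.Perm.mul_apply, mul_inv_cancel, Equiv.Perm.one_apply]

theorem numCycles_eq_card {Z : Type} {f : Equiv.Perm D} {g : D → Z} (hs : Function.Surjective g)
    (hg : ∀ x, g (f x) = g x) (hc : ∀ x y, g x = g y → f.SameCycle x y) :
    numCycles f = Nat.card Z := by
  let F : Quotient (Equiv.Perm.SameCycle.setoid f) → Z :=
    Quotient.lift g fun _ _ h => Equiv.Perm.SameCycle.apply_eq hg h
  refine Nat.card_congr (Equiv.ofBijective F ⟨?_, fun z => ?_⟩)
  · intro x y
    induction x, y using Quotient.inductionOn₂ with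
    | h x y => exact fun h => Quotient.sound (hc x y h)
  · obtain ⟨x, rfl⟩ := hs z
    exact ⟨Quotient.mk _ x, rfl⟩

theorem sameCycle_permCongr (e : D ≃ D') (f : Equiv.Perm D) (x y : D') :
    (e.permCongr f).SameCycle x y ↔ f.SameCycle (e.symm x) (e.symm y) := by
  have (i : ℤ) : e.permCongr f ^ i = e.permCongr (f ^ i) :=
    (map_zpow e.permCongrHom f i).symm
  simp only [Equiv.Perm.SameCycle, this, Equiv.permCongr_apply, Equiv.eq_symm_apply]

theorem numCycles_permCongr (e : D ≃ D') (f : Equiv.Perm D) :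
    numCycles (e.permCongr f) = numCycles f :=
  Nat.card_congr (Quotient.congr e.symm fun x y => sameCycle_permCongr e f x y)

theorem two_mul_numCycles_of_involutive [Finite D] {f : Equiv.Perm D} (hf : ∀ d, f (f d) = d)
    (hne : ∀ d, f d ≠ d) : 2 * numCycles f = Nat.card D := by
  refine (card_eq_mul_card_quotient (Equiv.Perm.SameCycle.setoid f) 2 fun x => ?_).symm
  have hset : {y | f.SameCycle x y} = {x, f x} := by
    ext y
    simp only [Set.mem_ofPred_eq, Set.mem_insert_iff, Set.mem_singleton_iff]
    constructor
    · intro h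
      -- The unordered pair `{z, f z}` is constant along the cycle.
      have := Equiv.Perm.SameCycle.apply_eq (g := fun z => ({z, f z} : Set D))
        (fun z => by simp only [hf]; exact Set.pair_comm _ _) h
      have hy : y ∈ ({x, f x} : Set D) := by
        rw [show ({x, f x} : Set D) = {y, f y} from this]
        exact Set.mem_insert _ _
      simpa using hy
    · rintro (rfl | rfl)
      · exact .refl _ _
      · exact ⟨1, by simp⟩
  have : Nat.card {y // f.SameCycle x y} = ({x, f x} : Set D).ncard := by
    rw [← hset]; exact Nat.card_coe_set_eq _
  exact this.trans (Set.ncard_pair (hne x).symm)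

/-! ### First return maps and their cycles -/

/-- `ρ` is the first return map of `g` to the range of `f`. -/
def IsFirstReturn (f : T ↪ D) (g : Equiv.Perm D) (ρ : Equiv.Perm T) : Prop :=
  ∀ d, ∃ k : ℕ, 0 < k ∧ (g ^ k) (f d) = f (ρ d) ∧
    ∀ j : ℕ, 0 < j → j < k → (g ^ j) (f d) ∉ Set.range f

/-- An excursion outside the range does not see `β`, which acts only once, at the moment of return.
-/
theorem IsFirstReturn.viaEmbedding_mul {f : T ↪ D} {g : Equiv.Perm D} {ρ : Equiv.Perm T}
    (h : IsFirstReturn f g ρ) (β : Equiv.Perm T) :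
    IsFirstReturn f (β.viaEmbedding f * g) (β * ρ) := by
  intro d
  obtain ⟨k, hk, hkd, hj⟩ := h d
  have heq (j : ℕ) : j < k → ((β.viaEmbedding f * g) ^ j) (f d) = (g ^ j) (f d) := by
    induction j with
    | zero => intro _; rfl
    | succ j ih =>
      intro hjk
      rw [pow_succ', Equiv.Perm.mul_apply, ih (by omega), Equiv.Perm.mul_apply,
        ← Equiv.Perm.mul_apply g, ← pow_succ',
        Equiv.Perm.viaEmbedding_apply_of_notMem _ _ _ (hj _ (by omega) hjk)]
  refine ⟨k, hk, ?_, fun j hj0 hjk => by rw [heq j hjk]; exact hj j hj0 hjk⟩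
  obtain ⟨k, rfl⟩ := Nat.exists_eq_succ_of_ne_zero hk.ne'
  rw [Nat.succ_eq_add_one, pow_succ', Equiv.Perm.mul_apply, heq k (by omega),
    Equiv.Perm.mul_apply, ← Equiv.Perm.mul_apply g, ← pow_succ', hkd,
    Equiv.Perm.viaEmbedding_apply, Equiv.Perm.mul_apply]

theorem IsFirstReturn.sameCycle_iff [Finite D] {f : T ↪ D} {g : Equiv.Perm D} {ρ : Equiv.Perm T}
    (h : IsFirstReturn f g ρ) {d d' : T} : g.SameCycle (f d) (f d') ↔ ρ.SameCycle d d' := by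
  constructor
  · intro hg
    obtain ⟨n, hn⟩ := hg.exists_nat_pow_eq
    clear hg
    induction n using Nat.strong_induction_on generalizing d with
    | _ n ih =>
      rcases Nat.eq_zero_or_pos n with rfl | hpos
      · rw [f.injective hn]
      · obtain ⟨k, hk, hkd, hj⟩ := h d
        have hkn : k ≤ n := by
          by_contra hlt
          exact hj n hpos (by omega) (hn ▸ Set.mem_range_self d')
        refine (Equiv.Perm.SameCycle.trans ⟨1, by simp⟩ (ih (n - k) (by omega) (d := ρ d) ?_))
        rw [← hkd, ← Equiv.Perm.mul_apply, ← pow_add, Nat.sub_add_cancel hkn, hn]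
  · intro hρ
    have hq := Equiv.Perm.SameCycle.apply_eq
      (g := fun z => Quotient.mk (Equiv.Perm.SameCycle.setoid g) (f z)) (f := ρ)
      (fun z => by
        obtain ⟨k, -, hk, -⟩ := h z
        exact Quotient.sound (Equiv.Perm.SameCycle.symm ⟨k, by rw [zpow_natCast, hk]⟩)) hρ
    exact Quotient.exact hq

/-- The cycles of `g` that avoid `R`, as sets. -/
def avoidingCycles (g : Equiv.Perm D) (R : Set D) : Set (Set D) :=
  {C | (∃ x, C = {y | g.SameCycle x y}) ∧ Disjoint C R}

/-- A cycle of `g` that meets the range traces exactly one cycle of `ρ` on it; the other cycles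
avoid the range. -/
theorem numCycles_eq_add [Finite D] {f : T ↪ D} {g : Equiv.Perm D} {ρ : Equiv.Perm T}
    (h : IsFirstReturn f g ρ) :
    numCycles g = numCycles ρ + (avoidingCycles g (Set.range f)).ncard := by
  classical
  have hT : Finite T := Finite.of_injective f f.injective
  let c : D → Set D := fun x => {y | g.SameCycle x y}
  have hc {x y : D} : c x = c y ↔ g.SameCycle x y := by
    refine ⟨fun hxy => ?_, fun hxy => ?_⟩
    · have : y ∈ c y := Equiv.Perm.SameCycle.refl _ _
      rwa [← hxy] at this
    · ext z
      exact ⟨fun hz => hxy.symm.trans hz, fun hz => hxy.trans hz⟩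
  have h1 : numCycles g = (Set.range c).ncard := by
    rw [← Nat.card_coe_set_eq]
    refine numCycles_eq_card (g := Set.rangeFactorization c) Set.rangeFactorization_surjective
      (fun x => ?_) fun x y hxy => hc.1 (congrArg Subtype.val hxy)
    refine Subtype.ext (hc.2 (Equiv.Perm.SameCycle.symm ⟨1, by simp⟩))
  have h2 : numCycles ρ = (Set.range (c ∘ f)).ncard := by
    rw [← Nat.card_coe_set_eq]
    refine numCycles_eq_card (g := Set.rangeFactorization (c ∘ f))
      Set.rangeFactorization_surjective (fun x => ?_)
      fun x y hxy => h.sameCycle_iff.1 (hc.1 (congrArg Subtype.val hxy))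
    exact Subtype.ext (hc.2 (h.sameCycle_iff.2 (Equiv.Perm.SameCycle.symm ⟨1, by simp⟩)))
  rw [h1, h2, ← Set.ncard_union_eq]
  · congr 1
    ext C
    constructor
    · rintro ⟨x, rfl⟩
      by_cases hx : Disjoint (c x) (Set.range f)
      · exact Or.inr ⟨⟨x, rfl⟩, hx⟩
      · rw [Set.not_disjoint_iff] at hx
        obtain ⟨_, hy, d, rfl⟩ := hx
        exact Or.inl ⟨d, (hc.2 hy).symm⟩
    · rintro (⟨d, rfl⟩ | ⟨⟨x, rfl⟩, -⟩)
      · exact ⟨f d, rfl⟩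
      · exact ⟨x, rfl⟩
  · rw [Set.disjoint_left]
    rintro _ ⟨d, rfl⟩ ⟨-, hd⟩
    exact Set.disjoint_left.1 hd (Equiv.Perm.SameCycle.refl _ _) ⟨d, rfl⟩

/-- Along a cycle avoiding `R` all values of `g` lie outside `R`, so `g'` follows the same path. -/
theorem avoidingCycles_subset [Finite D] {g g' : Equiv.Perm D} {R : Set D}
    (h : ∀ x, g x ∉ R → g' x = g x) : avoidingCycles g R ⊆ avoidingCycles g' R := by
  rintro _ ⟨⟨x, rfl⟩, hx⟩
  refine ⟨⟨x, ?_⟩, hx⟩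
  have hpow (n : ℕ) : (g' ^ n) x = (g ^ n) x := by
    induction n with
    | zero => rfl
    | succ n ih =>
      have hn : (g ^ (n + 1)) x ∉ R :=
        Set.disjoint_left.1 hx ⟨((n + 1 : ℕ) : ℤ), by rw [zpow_natCast]⟩
      rw [pow_succ', Equiv.Perm.mul_apply] at hn
      rw [pow_succ', pow_succ', Equiv.Perm.mul_apply, Equiv.Perm.mul_apply, ih, h _ hn]
  ext y
  constructor <;> intro hy <;> obtain ⟨n, hn⟩ := Equiv.Perm.SameCycle.exists_nat_pow_eq hy
  · exact ⟨n, by rw [zpow_natCast, hpow, hn]⟩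
  · exact ⟨n, by rw [zpow_natCast, ← hpow, hn]⟩

theorem viaEmbedding_mem_range_iff (f : T ↪ D) (β : Equiv.Perm T) (x : D) :
    β.viaEmbedding f x ∈ Set.range f ↔ x ∈ Set.range f := by
  by_cases hx : x ∈ Set.range f
  · obtain ⟨d, rfl⟩ := hx
    simp [Equiv.Perm.viaEmbedding_apply]
  · rw [Equiv.Perm.viaEmbedding_apply_of_notMem _ _ _ hx]

theorem avoidingCycles_viaEmbedding_mul [Finite D] (f : T ↪ D) (β : Equiv.Perm T)
    (g : Equiv.Perm D) : avoidingCycles (β.viaEmbedding f * g) (Set.range f) =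
      avoidingCycles g (Set.range f) := by
  refine Set.Subset.antisymm (avoidingCycles_subset fun x hx => ?_)
    (avoidingCycles_subset fun x hx => ?_)
  · rw [Equiv.Perm.mul_apply, viaEmbedding_mem_range_iff] at hx
    rw [Equiv.Perm.mul_apply, Equiv.Perm.viaEmbedding_apply_of_notMem _ _ _ hx]
  · rw [Equiv.Perm.mul_apply, Equiv.Perm.viaEmbedding_apply_of_notMem _ _ _ hx]

/-- Composing with a permutation of the range of `f` that leaves the number of cycles of the
first return map unchanged leaves the number of cycles unchanged. -/
theorem numCycles_viaEmbedding_mul [Finite D] {f : T ↪ D} {g : Equiv.Perm D} {ρ : Equiv.Perm T}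
    (h : IsFirstReturn f g ρ) (β : Equiv.Perm T) (hβ : numCycles (β * ρ) = numCycles ρ) :
    numCycles (β.viaEmbedding f * g) = numCycles g := by
  rw [numCycles_eq_add (h.viaEmbedding_mul β), numCycles_eq_add h, hβ,
    avoidingCycles_viaEmbedding_mul]

/-! ### Permutations with a single cycle -/

theorem isCycle_of_numCycles_eq_one [Finite D] [Nontrivial D] {f : Equiv.Perm D}
    (h : numCycles f = 1) : f.IsCycle ∧ ∀ d, f d ≠ d := by
  have hall (x y : D) : f.SameCycle x y :=
    Quotient.exact ((Nat.card_eq_one_iff_unique.1 h).1.elim (Quotient.mk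
      (Equiv.Perm.SameCycle.setoid f) x) (Quotient.mk _ y))
  have hne (d : D) : f d ≠ d := by
    intro hd
    obtain ⟨y, hy⟩ := exists_ne d
    exact hy ((hall d y).eq_of_left hd).symm
  obtain ⟨x, -⟩ := exists_pair_ne D
  exact ⟨⟨x, hne x, fun y _ => hall x y⟩, hne⟩

/-- Two cycles with full support are conjugate. Applied to face permutations, this aligns the
contours of two trees. -/
theorem exists_permCongr_of_numCycles_eq_one [Finite D] [Nontrivial D] {f g : Equiv.Perm D}
    (hf : numCycles f = 1) (hg : numCycles g = 1) : ∃ b : Equiv.Perm D, b.permCongr f = g := by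
  classical
  have : Fintype D := Fintype.ofFinite D
  have supp {f : Equiv.Perm D} (h : ∀ d, f d ≠ d) : f.support = Finset.univ := by
    ext d; simpa using h d
  obtain ⟨hf, hf'⟩ := isCycle_of_numCycles_eq_one hf
  obtain ⟨hg, hg'⟩ := isCycle_of_numCycles_eq_one hg
  obtain ⟨b, hb⟩ := isConj_iff.1 (hf.isConj hg (by rw [supp hf', supp hg']))
  exact ⟨b, by rw [← hb]; ext; rfl⟩

end Cycles

/-! ### Connectedness -/

/-- Invariant sets only involve the generators, which makes connectedness easy to transfer when
these are modified. -/
theorem transitive_closure_iff {D : Type} [Finite D] (σ α : Equiv.Perm D) :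
    (∀ d d', ∃ g ∈ Subgroup.closure {σ, α}, g d = d') ↔
      ∀ O : Set D, (∀ d, σ d ∈ O ↔ d ∈ O) → (∀ d, α d ∈ O ↔ d ∈ O) → O.Nonempty →
        O = Set.univ := by
  constructor
  · rintro h O hσ hα ⟨x, hx⟩
    have key : ∀ g ∈ Subgroup.closure {σ, α}, ∀ d, g d ∈ O ↔ d ∈ O := by
      intro g hg
      induction hg using Subgroup.closure_induction with
      | mem g hg =>
        rcases hg with rfl | rfl
        exacts [hσ, hα]
      | one => intro d; rfl
      | mul g g' _ _ ih ih' => intro d; rw [Equiv.Perm.mul_apply, ih, ih']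
      | inv g _ ih => intro d; rw [← ih, ← Equiv.Perm.mul_apply, mul_inv_cancel, Equiv.Perm.one_apply]
    refine Set.eq_univ_of_forall fun y => ?_
    obtain ⟨g, hg, rfl⟩ := h x y
    exact (key g hg x).2 hx
  · intro h x y
    have inv {τ : Equiv.Perm D} (hτ : τ ∈ Subgroup.closure {σ, α}) (d : D) :
        (∃ g ∈ Subgroup.closure {σ, α}, g x = τ d) ↔ ∃ g ∈ Subgroup.closure {σ, α}, g x = d := by
      constructor
      · rintro ⟨g, hg, hgd⟩
        exact ⟨τ⁻¹ * g, mul_mem (inv_mem hτ) hg, by simp [hgd]⟩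
      · rintro ⟨g, hg, rfl⟩
        exact ⟨τ * g, mul_mem hτ hg, rfl⟩
    have := h {d | ∃ g ∈ Subgroup.closure {σ, α}, g x = d}
      (inv (Subgroup.subset_closure (by simp))) (inv (Subgroup.subset_closure (by simp)))
      ⟨x, 1, one_mem _, rfl⟩
    exact Set.eq_univ_iff_forall.1 this y

namespace PlanarMap

variable {D D' T : Type}

/-! ### Relabelling, rigidity -/

theorem eq_univ_of_invariant [Finite D] (M : PlanarMap D) {O : Set D}
    (hσ : ∀ d, M.σ d ∈ O ↔ d ∈ O) (hα : ∀ d, M.α d ∈ O ↔ d ∈ O) (hO : O.Nonempty) :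
    O = Set.univ :=
  (transitive_closure_iff _ _).1 M.connected O hσ hα hO

/-- Transport of a planar map along a bijection. -/
def relabel [Finite D] (M : PlanarMap D) (e : D ≃ D') : PlanarMap D' where
  σ := e.permCongr M.σ
  α := e.permCongr M.α
  α_invol d := by simp [Equiv.permCongr_apply, M.α_invol]
  α_ne d := by
    rw [Equiv.permCongr_apply, Ne, ← Equiv.eq_symm_apply]
    exact M.α_ne _
  connected := by
    have : Finite D' := Finite.of_equiv D e
    rw [transitive_closure_iff]
    intro O hσ hα hO
    have := M.eq_univ_of_invariant (O := e ⁻¹' O) (fun d => by simpa using hσ (e d))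
      (fun d => by simpa using hα (e d)) (hO.preimage e.surjective)
    rwa [Set.preimage_eq_univ_iff, e.surjective.range_eq, Set.univ_subset_iff] at this
  euler := by
    have : (e.permCongr M.σ)⁻¹ * e.permCongr M.α = e.permCongr (M.σ⁻¹ * M.α) := by
      change (e.permCongrHom M.σ)⁻¹ * e.permCongrHom M.α = e.permCongrHom (M.σ⁻¹ * M.α)
      rw [map_mul, map_inv]
    rw [this, numCycles_permCongr, numCycles_permCongr, numCycles_permCongr, M.euler]

theorem isIso_relabel [Finite D] (M : PlanarMap D) (e : D ≃ D') : M.IsIso (M.relabel e) e :=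
  ⟨fun d => by simp [relabel, Equiv.permCongr_apply],
    fun d => by simp [relabel, Equiv.permCongr_apply]⟩

theorem IsIso.eq_relabel [Finite D] {M : PlanarMap D} {N : PlanarMap D'} {e : D ≃ D'}
    (h : M.IsIso N e) : N = M.relabel e := by
  ext d
  · simp [relabel, Equiv.permCongr_apply, h.map_σ]
  · simp [relabel, Equiv.permCongr_apply, h.map_α]

theorem IsIso.face_eq {M : PlanarMap D} {N : PlanarMap D'} {e : D ≃ D'}
    (h : M.IsIso N e) : N.face = e.permCongr M.face := by
  ext d
  simp [Equiv.permCongr_apply, h.map_face]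

theorem IsTree.relabel [Finite D] {M : PlanarMap D} (h : M.IsTree) (e : D ≃ D') :
    (M.relabel e).IsTree := by
  rw [IsTree, (M.isIso_relabel e).face_eq, numCycles_permCongr]
  exact h

/-- Isomorphisms of maps that agree at one oriented edge are equal. -/
theorem IsIso.eq_of_apply_eq [Finite D] {M : PlanarMap D} {N : PlanarMap D'} {e e' : D ≃ D'}
    (h : M.IsIso N e) (h' : M.IsIso N e') {d : D} (hd : e d = e' d) : e = e' := by
  have := M.eq_univ_of_invariant (O := {x | e x = e' x})
    (fun x => by simp [h.map_σ, h'.map_σ]) (fun x => by simp [h.map_α, h'.map_α]) ⟨d, hd⟩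
  ext x
  exact Set.eq_univ_iff_forall.1 this x

theorem IsSubmap.isIso {M : PlanarMap D} {N : PlanarMap D'} {T' : Type} {t : PlanarMap T}
    {t' : PlanarMap T'} {f : T ↪ D} {f' : T' ↪ D'} (h : t.IsSubmap M f) {a : D ≃ D'} {b : T ≃ T'}
    (ha : M.IsIso N a) (hb : t.IsIso t' b) (hf : ∀ d, a (f d) = f' (b d)) : t'.IsSubmap N f' := by
  have hpow (j : ℕ) (d : D) : (N.σ ^ j) (a d) = a ((M.σ ^ j) d) := by
    induction j with
    | zero => rfl
    | succ j ih =>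
      rw [pow_succ', pow_succ', Equiv.Perm.mul_apply, ih, Equiv.Perm.mul_apply, ha.map_σ]
  refine ⟨fun d => ?_, fun d => ?_⟩
  · obtain ⟨d, rfl⟩ := b.surjective d
    rw [← hb.map_α, ← hf, ← hf, h.map_α, ha.map_α]
  · obtain ⟨d, rfl⟩ := b.surjective d
    obtain ⟨k, hk, hkd, hj⟩ := h.map_σ d
    refine ⟨k, hk, by rw [← hf, hpow, hkd, hf, hb.map_σ], fun j hj0 hjk hmem => ?_⟩
    rw [← hf, hpow] at hmem
    obtain ⟨y, hy⟩ := hmem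
    obtain ⟨y, rfl⟩ := b.surjective y
    rw [← hf] at hy
    exact hj j hj0 hjk ⟨y, a.injective hy⟩

/-! ### Cutting along a tree and gluing along another one -/

theorem α_mul_α (M : PlanarMap D) : M.α * M.α = 1 := Equiv.ext M.α_invol

theorem face_inv (M : PlanarMap D) : M.face⁻¹ = M.α * M.σ := by
  rw [face, mul_inv_rev, inv_inv, inv_eq_of_mul_eq_one_left M.α_mul_α]

/-- Euler's formula with one face: the number of edges is half the number of oriented edges, so the
number of vertices is forced. -/
theorem numCycles_σ_of_isTree [Finite D] {t t' : PlanarMap D} (h : t.IsTree) (h' : t'.IsTree) :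
    numCycles t.σ = numCycles t'.σ := by
  have e := t.euler
  have e' := t'.euler
  have := two_mul_numCycles_of_involutive t.α_invol t.α_ne
  have := two_mul_numCycles_of_involutive t'.α_invol t'.α_ne
  have h : numCycles (t.σ⁻¹ * t.α) = 1 := h
  have h' : numCycles (t'.σ⁻¹ * t'.α) = 1 := h'
  omega

section Reglue

variable {M : PlanarMap D} {t t' : PlanarMap T} {f : T ↪ D}

theorem viaEmbedding_mul_α_apply (h : t.IsSubmap M f) (d : T) :
    ((t'.α * t.α).viaEmbedding f * M.α) (f d) = f (t'.α d) := by
  rw [Equiv.Perm.mul_apply, ← h.map_α, Equiv.Perm.viaEmbedding_apply, Equiv.Perm.mul_apply,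
    t.α_invol]

theorem IsSubmap.α_mem_range_iff (h : t.IsSubmap M f) (d : D) :
    M.α d ∈ Set.range f ↔ d ∈ Set.range f := by
  have key : ∀ d, d ∈ Set.range f → M.α d ∈ Set.range f := by
    rintro _ ⟨d, rfl⟩
    exact ⟨_, h.map_α d⟩
  exact ⟨fun hd => M.α_invol d ▸ key _ hd, key d⟩

theorem viaEmbedding_mul_α_apply_of_notMem (h : t.IsSubmap M f) (β : Equiv.Perm T) {d : D}
    (hd : d ∉ Set.range f) : (β.viaEmbedding f * M.α) d = M.α d := by
  rw [Equiv.Perm.mul_apply, Equiv.Perm.viaEmbedding_apply_of_notMem]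
  rwa [h.α_mem_range_iff]

/-- Equal contours mean `t.α * t.σ = t'.α * t'.σ`, hence `t'.σ = (t'.α * t.α) * t.σ`: the correction
on the map induces exactly the rotation of `t'`. -/
theorem isFirstReturn_reglue (h : t.IsSubmap M f) (hface : t.face = t'.face) :
    IsFirstReturn f ((t'.α * t.α).viaEmbedding f * M.σ) t'.σ := by
  have h1 : t'.σ = t'.α * t.α * t.σ := by
    rw [mul_assoc, ← face_inv, hface, face_inv, ← mul_assoc, α_mul_α, one_mul]
  rw [h1]
  exact IsFirstReturn.viaEmbedding_mul h.map_σ _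

theorem reglue_connected [Finite D] [Nonempty T] (h : t.IsSubmap M f) (hface : t.face = t'.face)
    {O : Set D} (hσ : ∀ d, ((t'.α * t.α).viaEmbedding f * M.σ) d ∈ O ↔ d ∈ O)
    (hα : ∀ d, ((t'.α * t.α).viaEmbedding f * M.α) d ∈ O ↔ d ∈ O) (hO : O.Nonempty) :
    O = Set.univ := by
  have hT : Finite T := Finite.of_injective f f.injective
  have hpow (k : ℕ) (d : D) : (((t'.α * t.α).viaEmbedding f * M.σ) ^ k) d ∈ O ↔ d ∈ O := by
    induction k with
    | zero => rfl
    | succ k ih => rw [pow_succ', Equiv.Perm.mul_apply, hσ, ih]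
  -- The trace of `O` on the tree is invariant under `t'`, which is connected; so `O` contains all
  -- of the tree or none of it.
  have hR : (∀ d, f d ∈ O) ∨ ∀ d, f d ∉ O := by
    by_contra! hcon
    obtain ⟨⟨x, hx⟩, y, hy⟩ := hcon
    have := t'.eq_univ_of_invariant (O := f ⁻¹' O) (fun d => ?_) (fun d => ?_) ⟨y, hy⟩
    · exact hx (Set.eq_univ_iff_forall.1 this x)
    · obtain ⟨k, -, hk, -⟩ := isFirstReturn_reglue h hface d
      rw [Set.mem_preimage, ← hk, hpow]
      rfl
    · rw [Set.mem_preimage, ← viaEmbedding_mul_α_apply h, hα]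
      rfl
  have hα' (d : D) : M.α d ∈ O ↔ d ∈ O := by
    by_cases hd : d ∈ Set.range f
    · obtain ⟨d, rfl⟩ := hd
      rw [← h.map_α]
      rcases hR with hR | hR <;> simp [hR]
    · rw [← viaEmbedding_mul_α_apply_of_notMem h (t'.α * t.α) hd, hα]
  refine M.eq_univ_of_invariant (fun d => ?_) hα' hO
  -- The new reversal sends `M.α (M.σ d)` to the new rotation of `d`, because `M.α` cancels.
  rw [← hα' (M.σ d), ← hα (M.α (M.σ d)), ← hσ d, Equiv.Perm.mul_apply, Equiv.Perm.mul_apply,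
    M.α_invol]

/-- The map obtained from `M` by cutting it along its subtree `t` and gluing the boundary of
length `2 m` that appears along another tree `t'` with the same contour. -/
noncomputable def reglue [Finite D] [Nonempty T] (M : PlanarMap D) (t t' : PlanarMap T)
    (f : T ↪ D) (h : t.IsSubmap M f) (hface : t.face = t'.face)
    (hV : numCycles t.σ = numCycles t'.σ) : PlanarMap D where
  σ := (t'.α * t.α).viaEmbedding f * M.σ
  α := (t'.α * t.α).viaEmbedding f * M.α
  α_invol d := by
    by_cases hd : d ∈ Set.range f
    · obtain ⟨d, rfl⟩ := hd
      rw [viaEmbedding_mul_α_apply h, viaEmbedding_mul_α_apply h, t'.α_invol]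
    · rw [viaEmbedding_mul_α_apply_of_notMem h _ hd, viaEmbedding_mul_α_apply_of_notMem h,
        M.α_invol]
      rwa [h.α_mem_range_iff]
  α_ne d := by
    by_cases hd : d ∈ Set.range f
    · obtain ⟨d, rfl⟩ := hd
      rw [viaEmbedding_mul_α_apply h]
      exact fun hd => t'.α_ne d (f.injective hd)
    · rw [viaEmbedding_mul_α_apply_of_notMem h _ hd]
      exact M.α_ne d
  connected := (transitive_closure_iff _ _).2 fun _ => reglue_connected h hface
  euler := by
    have hT : Finite T := Finite.of_injective f f.injective
    have h1 : t'.α * t.α * t.σ = t'.σ := by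
      rw [mul_assoc, ← face_inv, hface, face_inv, ← mul_assoc, α_mul_α, one_mul]
    have h2 : t'.α * t.α * t.α = t'.α := by rw [mul_assoc, α_mul_α, mul_one]
    have hα : IsFirstReturn f M.α t.α :=
      fun d => ⟨1, one_pos, by rw [pow_one, h.map_α], fun j h0 h1 => by omega⟩
    have := two_mul_numCycles_of_involutive t.α_invol t.α_ne
    have := two_mul_numCycles_of_involutive t'.α_invol t'.α_ne
    -- Vertices and edges keep their number because the first return maps pass from `t.σ`, `t.α` to
    -- `t'.σ`, `t'.α`; in the face permutation the correction cancels.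
    rw [numCycles_viaEmbedding_mul h.map_σ _ (by rw [h1, hV]),
      numCycles_viaEmbedding_mul hα _ (by rw [h2]; omega), ← M.euler]
    congr 2
    group

variable [Finite D] [Nonempty T] (h : t.IsSubmap M f) (hface : t.face = t'.face)
  (hV : numCycles t.σ = numCycles t'.σ)

theorem isSubmap_reglue : t'.IsSubmap (reglue M t t' f h hface hV) f :=
  ⟨fun d => (viaEmbedding_mul_α_apply h d).symm, isFirstReturn_reglue h hface⟩

theorem face_reglue : (reglue M t t' f h hface hV).face = M.face := by
  simp only [face, reglue]
  group

theorem reglue_injective {M' : PlanarMap D} (h' : t.IsSubmap M' f)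
    (heq : reglue M t t' f h hface hV = reglue M' t t' f h' hface hV) : M = M' := by
  ext1
  · exact mul_left_cancel (congrArg PlanarMap.σ heq)
  · exact mul_left_cancel (congrArg PlanarMap.α heq)

end Reglue

/-! ### Stars -/

/-- Rotation around the centre of the star with `N + 1` edges. -/
def starRotation (N : ℕ) : Equiv.Perm (Fin (N + 1) × Bool) where
  toFun x := if x.2 then (x.1 + 1, true) else x
  invFun x := if x.2 then (x.1 - 1, true) else x
  left_inv := by rintro ⟨i, _ | _⟩ <;> simp
  right_inv := by rintro ⟨i, _ | _⟩ <;> simp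

def starReversal (N : ℕ) : Equiv.Perm (Fin (N + 1) × Bool) where
  toFun x := (x.1, !x.2)
  invFun x := (x.1, !x.2)
  left_inv := by rintro ⟨i, _ | _⟩ <;> simp
  right_inv := by rintro ⟨i, _ | _⟩ <;> simp

theorem starRotation_sameCycle (N : ℕ) (i j : Fin (N + 1)) :
    (starRotation N).SameCycle (i, true) (j, true) := by
  have key (i : Fin (N + 1)) : (starRotation N).SameCycle (0, true) (i, true) := by
    induction i using Fin.induction with
    | zero => exact .refl _ _
    | succ i ih =>
      refine ih.trans ⟨1, ?_⟩
      rw [zpow_one]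
      simp [starRotation]
  exact (key i).symm.trans (key j)

theorem numCycles_starRotation (N : ℕ) : numCycles (starRotation N) = N + 2 := by
  rw [numCycles_eq_card (Z := Option (Fin (N + 1)))
    (g := fun x => if x.2 then none else some x.1)]
  · simp
  · rintro (_ | i)
    exacts [⟨(0, true), rfl⟩, ⟨(i, false), rfl⟩]
  · rintro ⟨i, _ | _⟩ <;> simp [starRotation]
  · rintro ⟨i, _ | _⟩ ⟨j, _ | _⟩ hij <;> simp at hij
    · rw [hij]
    · exact starRotation_sameCycle N i j

theorem starFace_sameCycle (N : ℕ) (x y : Fin (N + 1) × Bool) :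
    ((starRotation N)⁻¹ * starReversal N).SameCycle x y := by
  have step (i : Fin (N + 1)) : ((starRotation N)⁻¹ * starReversal N).SameCycle
      (i, true) (i, false) :=
    ⟨1, by rw [zpow_one, Equiv.Perm.mul_apply, Equiv.Perm.inv_eq_iff_eq]; rfl⟩
  -- With `step`, this walks round the star: in along edge `i + 1`, then out along edge `i`.
  have step' (i : Fin (N + 1)) : ((starRotation N)⁻¹ * starReversal N).SameCycle
      (i + 1, false) (i, true) :=
    ⟨1, by rw [zpow_one, Equiv.Perm.mul_apply, Equiv.Perm.inv_eq_iff_eq]; rfl⟩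
  have key (i : Fin (N + 1)) : ((starRotation N)⁻¹ * starReversal N).SameCycle
      (0, true) (i, true) := by
    induction i using Fin.induction with
    | zero => exact .refl _ _
    | succ i ih =>
      refine ih.trans ((step _).trans ?_).symm
      rw [← Fin.coeSucc_eq_succ]
      exact step' _
  have key' (x : Fin (N + 1) × Bool) : ((starRotation N)⁻¹ * starReversal N).SameCycle
      (0, true) x := by
    obtain ⟨i, _ | _⟩ := x
    exacts [(key i).trans (step i), key i]
  exact (key' x).symm.trans (key' y)

theorem numCycles_starFace (N : ℕ) :
    numCycles ((starRotation N)⁻¹ * starReversal N) = 1 := by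
  rw [numCycles_eq_card (Z := Unit) (g := fun _ => ()) (fun _ => ⟨(0, true), rfl⟩)
    (fun _ => rfl) fun x y _ => starFace_sameCycle N x y]
  simp

/-- The star with `N + 1` edges; `(i, true)` is the `i`-th oriented edge from the centre. -/
def star (N : ℕ) : PlanarMap (Fin (N + 1) × Bool) where
  σ := starRotation N
  α := starReversal N
  α_invol := by rintro ⟨i, _ | _⟩ <;> rfl
  α_ne := by rintro ⟨i, _ | _⟩ <;> simp [starReversal]
  connected x y := by
    obtain ⟨i, hi⟩ := starFace_sameCycle N x y
    exact ⟨_, zpow_mem (mul_mem (inv_mem (Subgroup.subset_closure (by simp)))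
      (Subgroup.subset_closure (by simp))) i, hi⟩
  euler := by
    have := two_mul_numCycles_of_involutive (f := starReversal N)
      (by rintro ⟨i, _ | _⟩ <;> rfl) (by rintro ⟨i, _ | _⟩ <;> simp [starReversal])
    rw [Nat.card_prod, Nat.card_fin, Nat.card_eq_fintype_card, Fintype.card_bool] at this
    rw [numCycles_starRotation, numCycles_starFace]
    omega

theorem isTree_star (N : ℕ) : (star N).IsTree := numCycles_starFace N

theorem starRotation_pow_apply (N k : ℕ) (i : Fin (N + 1)) :
    ((starRotation N) ^ k) (i, true) = (Fin.ofNat (N + 1) (i + k), true) := by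
  induction k with
  | zero => simp
  | succ k ih =>
    rw [pow_succ', Equiv.Perm.mul_apply, ih]
    simp [starRotation, Fin.ext_iff, Fin.val_add, add_assoc]

theorem isSubmap_star {M N : ℕ} (hMN : M ≤ N) :
    (star M).IsSubmap (star N)
      ((Fin.castLEEmb (Nat.succ_le_succ hMN)).prodMap (.refl Bool)) := by
  refine ⟨fun d => rfl, ?_⟩
  rintro ⟨i, _ | _⟩
  · exact ⟨1, one_pos, by simp [star, starRotation], fun j h0 h1 => by omega⟩
  · have hle := Nat.succ_le_succ hMN
    change ∃ k : ℕ, 0 < k ∧ ((starRotation N) ^ k) (Fin.castLE hle i, true) =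
      (Fin.castLE hle (i + 1), true) ∧ ∀ j : ℕ, 0 < j → j < k →
        ((starRotation N) ^ j) (Fin.castLE hle i, true) ∉
          Set.range ((Fin.castLEEmb hle).prodMap (.refl Bool))
    simp only [starRotation_pow_apply, Prod.mk.injEq, and_true]
    rcases (Nat.lt_succ_iff.1 i.2).lt_or_eq with hi | hi
    · refine ⟨1, one_pos, ?_, fun j h0 h1 => by omega⟩
      ext
      rw [Fin.val_ofNat, Fin.val_castLE, Fin.val_castLE, Fin.val_add_one_of_lt (by
        rwa [Fin.lt_def, Fin.val_last]), Nat.mod_eq_of_lt (by omega)]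
    -- From the last kept edge, `M`, the rotation passes the `N - M` suppressed edges before
    -- reaching edge `0`.
    · refine ⟨N - M + 1, by omega, ?_, fun j h0 h1 => ?_⟩
      · have : i = Fin.last M := Fin.ext hi
        subst this
        ext
        rw [Fin.val_ofNat, Fin.val_castLE, Fin.val_castLE, Fin.last_add_one, Fin.val_last,
          show M + (N - M + 1) = N + 1 by omega, Nat.mod_self]
        rfl
      · rintro ⟨⟨x, b⟩, hx⟩
        have hx := congrArg (fun y : Fin (N + 1) × Bool => (y.1 : ℕ)) hx
        simp only [Fin.val_ofNat, Fin.val_castLE] at hx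
        rw [Nat.mod_eq_of_lt (by omega)] at hx
        change (x : ℕ) = _ at hx
        omega

end PlanarMap

/-! ### Images of uniform measures -/

theorem count_eq_ncard {W : Type*} [Finite W] [MeasurableSpace W] [DiscreteMeasurableSpace W]
    (S : Set W) : MeasureTheory.Measure.count S = (S.ncard : ENNReal) := by
  rw [MeasureTheory.Measure.count_apply (.of_discrete), ← S.toFinite.cast_ncard_eq,
    ENat.toENNReal_coe]

open MeasureTheory ProbabilityTheory in
-- Proportional fibres give proportional totals with the same constants, which cancel on
-- normalizing. That `L ≠ 0` follows from `K ≠ 0` and `A` being nonempty.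
theorem map_uniformOn_eq_map_uniformOn {X Y Z : Type*} [Finite X] [Finite Y] [Finite Z]
    [MeasurableSpace X] [MeasurableSpace Y] [MeasurableSpace Z] [DiscreteMeasurableSpace X]
    [DiscreteMeasurableSpace Y] [DiscreteMeasurableSpace Z] {A : Set X} {B : Set Y}
    (hA : A.Nonempty) {f : X → Z} {g : Y → Z} {K L : ℕ} (hK : K ≠ 0)
    (h : ∀ z, K * (A ∩ f ⁻¹' {z}).ncard = L * (B ∩ g ⁻¹' {z}).ncard) :
    (uniformOn A).map f = (uniformOn B).map g := by
  have key : (K : ENNReal) • (Measure.count.restrict A).map f =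
      (L : ENNReal) • (Measure.count.restrict B).map g := by
    refine Measure.ext_of_singleton fun z => ?_
    simp only [Measure.smul_apply, smul_eq_mul]
    rw [Measure.map_apply (.of_discrete) (.of_discrete),
      Measure.map_apply (.of_discrete) (.of_discrete), Measure.restrict_apply (.of_discrete),
      Measure.restrict_apply (.of_discrete), count_eq_ncard, count_eq_ncard, Set.inter_comm,
      Set.inter_comm _ B]
    exact_mod_cast h z
  have apply_eq (S : Set Z) : (K : ENNReal) * Measure.count (A ∩ f ⁻¹' S) =
      L * Measure.count (B ∩ g ⁻¹' S) := by
    have := congrArg (fun μ : Measure Z => μ S) key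
    simp only [Measure.smul_apply, smul_eq_mul] at this
    rwa [Measure.map_apply (.of_discrete) (.of_discrete),
      Measure.map_apply (.of_discrete) (.of_discrete), Measure.restrict_apply (.of_discrete),
      Measure.restrict_apply (.of_discrete), Set.inter_comm, Set.inter_comm _ B] at this
  have total : (K : ENNReal) * Measure.count A = L * Measure.count B := by
    simpa using apply_eq Set.univ
  have hL : L ≠ 0 := by
    rintro rfl
    rw [Nat.cast_zero, zero_mul, count_eq_ncard] at total
    have : K * A.ncard = 0 := by exact_mod_cast total
    exact (mul_ne_zero hK (hA.ncard_pos A.toFinite).ne') this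
  refine Measure.ext_of_singleton fun z => ?_
  rw [Measure.map_apply (.of_discrete) (.of_discrete),
    Measure.map_apply (.of_discrete) (.of_discrete), uniformOn, uniformOn,
    cond_apply (.of_discrete), cond_apply (.of_discrete), mul_comm, mul_comm (Measure.count B)⁻¹,
    ← div_eq_mul_inv, ← div_eq_mul_inv,
    ← ENNReal.mul_div_mul_left _ _ (Nat.cast_ne_zero.2 hK) (ENNReal.natCast_ne_top K),
    ← ENNReal.mul_div_mul_left (Measure.count (B ∩ _)) _ (Nat.cast_ne_zero.2 hL)
      (ENNReal.natCast_ne_top L), apply_eq, total]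

instance (m : ℕ) : DiscreteMeasurableSpace (PlaneTree m) := ⟨fun _ => trivial⟩

instance (m : ℕ) : DiscreteMeasurableSpace (PlantedTree m) := ⟨fun _ => trivial⟩

instance (e m : ℕ) : DiscreteMeasurableSpace (TreeDecoratedMap e m) := ⟨fun _ => trivial⟩

instance (e m : ℕ) : DiscreteMeasurableSpace (RootedOnTree e m) := ⟨fun _ => trivial⟩

/-! ### Sizes of isomorphism classes -/

namespace Decoration

variable {e m : ℕ}

/-- Relabelling of the oriented edges of the map and of the tree. -/
def relabel (x : Decoration e m) (a : Equiv.Perm (Fin (2 * (e + m))))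
    (b : Equiv.Perm (Fin (2 * m))) : Decoration e m where
  map := x.map.relabel a
  tree := ⟨x.tree.1.relabel b, x.tree.2.relabel b⟩
  emb := (b.symm.toEmbedding.trans x.emb).trans a.toEmbedding
  isSubmap := x.isSubmap.isIso (x.map.isIso_relabel a) (x.tree.1.isIso_relabel b) (by simp)

theorem isIso_relabel (x : Decoration e m) (a : Equiv.Perm (Fin (2 * (e + m))))
    (b : Equiv.Perm (Fin (2 * m))) : x.IsIso (x.relabel a b) a b :=
  ⟨x.map.isIso_relabel a, x.tree.1.isIso_relabel b, by simp [relabel]⟩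

variable {x y : Decoration e m} {a a' : Equiv.Perm (Fin (2 * (e + m)))}
  {b b' : Equiv.Perm (Fin (2 * m))}

theorem IsIso.eq_relabel (h : x.IsIso y a b) : y = x.relabel a b := by
  have h1 := h.map.eq_relabel
  have h2 := h.tree.eq_relabel
  have h3 : y.emb = (b.symm.toEmbedding.trans x.emb).trans a.toEmbedding := by
    ext1 d
    simp [h.emb]
  obtain ⟨M, ⟨t, ht⟩, f, hf⟩ := y
  simp only at h1 h2 h3
  subst h1 h2 h3
  rfl

/-- Rigidity of the map determines `a`, and injectivity of the embedding then determines `b`. -/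
theorem IsIso.eq_of_map_apply_eq (h : x.IsIso y a b) (h' : x.IsIso y a' b')
    {r : Fin (2 * (e + m))} (hr : a r = a' r) : a = a' ∧ b = b' := by
  obtain rfl := h.map.eq_of_apply_eq h'.map hr
  refine ⟨rfl, Equiv.ext fun d => y.emb.injective ?_⟩
  rw [← h.emb, ← h'.emb]

theorem IsIso.eq_of_tree_apply_eq (h : x.IsIso y a b) (h' : x.IsIso y a' b')
    {s : Fin (2 * m)} (hs : b s = b' s) : a = a' ∧ b = b' :=
  h.eq_of_map_apply_eq h' (r := x.emb s) (by rw [h.emb, h'.emb, hs])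

end Decoration

theorem card_perm_fin (n : ℕ) : Nat.card (Equiv.Perm (Fin n)) = n.factorial := by
  rw [Nat.card_perm, Nat.card_fin]

/-- The class is the orbit of `t` under relabelling, and the root makes this action free by
rigidity. The two counts for decorations below rest on the same argument, with independent
relabellings of map and tree. -/
theorem card_plantedTree_class {m : ℕ} (t : LabelledTree m × Fin (2 * m)) :
    Nat.card {t' // plantedTreeSetoid m t t'} = (2 * m).factorial := by
  rw [← card_perm_fin]
  refine (Nat.card_congr (Equiv.ofBijective (fun b : Equiv.Perm (Fin (2 * m)) =>
    (⟨(⟨t.1.1.relabel b, t.1.2.relabel b⟩, b t.2), b, t.1.1.isIso_relabel b, rfl⟩ :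
      {t' // plantedTreeSetoid m t t'})) ⟨fun b b' h => ?_, ?_⟩)).symm
  · have h := Prod.ext_iff.1 (congrArg Subtype.val h)
    have h1 : t.1.1.relabel b = t.1.1.relabel b' := congrArg Subtype.val h.1
    exact (t.1.1.isIso_relabel b).eq_of_apply_eq (h1 ▸ t.1.1.isIso_relabel b') h.2
  · rintro ⟨⟨⟨t', ht'⟩, s⟩, b, h, hs⟩
    simp only at h hs
    obtain rfl := h.eq_relabel
    exact ⟨b, by simp [hs]⟩

theorem card_rootedOnTree_class {e m : ℕ} (x : Decoration e m × Fin (2 * m)) :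
    Nat.card {y // rootedOnTreeSetoid e m x y} =
      (2 * (e + m)).factorial * (2 * m).factorial := by
  rw [← card_perm_fin, ← card_perm_fin, ← Nat.card_prod]
  refine (Nat.card_congr (Equiv.ofBijective
    (fun ab : Equiv.Perm (Fin (2 * (e + m))) × Equiv.Perm (Fin (2 * m)) =>
    (⟨(x.1.relabel ab.1 ab.2, ab.2 x.2), ab.1, ab.2, x.1.isIso_relabel ab.1 ab.2, rfl⟩ :
      {y // rootedOnTreeSetoid e m x y})) ⟨fun ab ab' h => ?_, ?_⟩)).symm
  · have h := Prod.ext_iff.1 (congrArg Subtype.val h)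
    have h1 : x.1.relabel ab.1 ab.2 = x.1.relabel ab'.1 ab'.2 := h.1
    exact Prod.ext_iff.2 ((x.1.isIso_relabel ab.1 ab.2).eq_of_tree_apply_eq
      (h1 ▸ x.1.isIso_relabel ab'.1 ab'.2) h.2)
  · rintro ⟨⟨y, s⟩, a, b, h, hs⟩
    simp only at h hs
    exact ⟨(a, b), by simp [hs, h.eq_relabel]⟩

theorem card_treeDecorated_class {e m : ℕ} (x : Decoration e m × Fin (2 * (e + m))) :
    Nat.card {y // treeDecoratedSetoid e m x y} =
      (2 * (e + m)).factorial * (2 * m).factorial := by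
  rw [← card_perm_fin, ← card_perm_fin, ← Nat.card_prod]
  refine (Nat.card_congr (Equiv.ofBijective
    (fun ab : Equiv.Perm (Fin (2 * (e + m))) × Equiv.Perm (Fin (2 * m)) =>
    (⟨(x.1.relabel ab.1 ab.2, ab.1 x.2), ab.1, ab.2, x.1.isIso_relabel ab.1 ab.2, rfl⟩ :
      {y // treeDecoratedSetoid e m x y})) ⟨fun ab ab' h => ?_, ?_⟩)).symm
  · have h := Prod.ext_iff.1 (congrArg Subtype.val h)
    have h1 : x.1.relabel ab.1 ab.2 = x.1.relabel ab'.1 ab'.2 := h.1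
    exact Prod.ext_iff.2 ((x.1.isIso_relabel ab.1 ab.2).eq_of_map_apply_eq
      (h1 ▸ x.1.isIso_relabel ab'.1 ab'.2) h.2)
  · rintro ⟨⟨y, r⟩, a, b, h, hr⟩
    simp only at h hr
    exact ⟨(a, b), by simp [hr, h.eq_relabel]⟩

/-! ### Number of maps decorated by a given tree -/

section Counting

variable {e m : ℕ}

/-- Regluing is an injection that fixes the face permutation as a labelled object, so an arbitrary
predicate `P` of it can be carried along. -/
theorem card_decoration_le (hm : 0 < m) (P : Equiv.Perm (Fin (2 * (e + m))) → Prop)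
    (t t' : LabelledTree m) :
    Nat.card {x : Decoration e m // x.tree = t ∧ P x.map.face} ≤
      Nat.card {x : Decoration e m // x.tree = t' ∧ P x.map.face} := by
  have : Nontrivial (Fin (2 * m)) := Fin.nontrivial_iff_two_le.2 (by omega)
  obtain ⟨b, hb⟩ := exists_permCongr_of_numCycles_eq_one t'.2 t.2
  have hface : t.1.face = (t'.1.relabel b).face := by
    rw [(t'.1.isIso_relabel b).face_eq, hb]
  have hV := PlanarMap.numCycles_σ_of_isTree t.2 (t'.2.relabel b)
  let F (x : {x : Decoration e m // x.tree = t ∧ P x.map.face}) : Decoration e m :=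
    have hx : t.1.IsSubmap x.1.map x.1.emb := by
      have := x.1.isSubmap
      rwa [x.2.1] at this
    { map := PlanarMap.reglue x.1.map t.1 (t'.1.relabel b) x.1.emb hx hface hV
      tree := t'
      -- Regluing uses the labels of `t'.1.relabel b`; precomposing with `b` returns to those of
      -- `t'`.
      emb := b.toEmbedding.trans x.1.emb
      isSubmap := (PlanarMap.isSubmap_reglue hx hface hV).isIso (.refl _)
        (t'.1.isIso_relabel b).symm (by simp) }
  refine Nat.card_le_card_of_injective
    (fun x => ⟨F x, rfl, by simp only [F, PlanarMap.face_reglue]; exact x.2.2⟩) ?_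
  rintro ⟨⟨M, u, f, hf⟩, rfl, hP⟩ ⟨⟨M', u', f', hf'⟩, hu, hP'⟩ h
  simp only at hu
  subst hu
  simp only [F, Subtype.mk.injEq, Decoration.mk.injEq, true_and] at h
  obtain ⟨h1, h2⟩ := h
  obtain rfl : f = f' := by
    ext1 d
    simpa using DFunLike.congr_fun h2 (b.symm d)
  obtain rfl := PlanarMap.reglue_injective hf hface hV hf' h1
  rfl

theorem exists_card_decoration_eq (hm : 0 < m) (P : Equiv.Perm (Fin (2 * (e + m))) → Prop) :
    ∃ c, ∀ t, Nat.card {x : Decoration e m // x.tree = t ∧ P x.map.face} = c := by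
  rcases isEmpty_or_nonempty (LabelledTree m) with h | ⟨⟨t⟩⟩
  · exact ⟨0, fun t => h.elim t⟩
  · exact ⟨_, fun t' => (card_decoration_le hm P t' t).antisymm (card_decoration_le hm P t t')⟩

theorem card_decoration_prod {P : Equiv.Perm (Fin (2 * (e + m))) → Prop} {c : ℕ}
    (hc : ∀ t, Nat.card {x : Decoration e m // x.tree = t ∧ P x.map.face} = c) {k : ℕ}
    (S : Set (LabelledTree m × Fin k)) :
    Nat.card {p : Decoration e m × Fin k // P p.1.map.face ∧ (p.1.tree, p.2) ∈ S} =
      c * S.ncard := by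
  have : Fintype S := Fintype.ofFinite _
  let E : {p : Decoration e m × Fin k // P p.1.map.face ∧ (p.1.tree, p.2) ∈ S} ≃
      Σ u : S, {x : Decoration e m // x.tree = u.1.1 ∧ P x.map.face} :=
    { toFun := fun p => ⟨⟨_, p.2.2⟩, p.1.1, rfl, p.2.1⟩
      invFun := fun q => ⟨(q.2.1, q.1.1.2), q.2.2.2, by rw [q.2.2.1]; exact q.1.2⟩
      left_inv := fun p => rfl
      right_inv := fun ⟨⟨⟨t, s⟩, hS⟩, ⟨x, hx, hP⟩⟩ => by
        obtain rfl : x.tree = t := hx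
        rfl }
  rw [Nat.card_congr E, Nat.card_sigma, Finset.sum_congr rfl fun u _ => hc _, Finset.sum_const,
    Finset.card_univ, ← Nat.card_eq_fintype_card, Nat.card_coe_set_eq, smul_eq_mul, mul_comm]

theorem ncard_labelled_planted (τ : PlantedTree m) :
    {u : LabelledTree m × Fin (2 * m) | Quotient.mk (plantedTreeSetoid m) u = τ}.ncard =
      (2 * m).factorial := by
  refine ((Nat.card_coe_set_eq _).symm.trans
    (card_mem_quotient_eq_mul (plantedTreeSetoid m) _ card_plantedTree_class {τ})).trans ?_
  exact (congrArg _ (Set.ncard_singleton τ)).trans (mul_one _)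

theorem ncard_labelled_prod (T : PlaneTree m) (k : ℕ) :
    {u : LabelledTree m × Fin k | Quotient.mk (planeTreeSetoid m) u.1 = T}.ncard =
      {t : LabelledTree m | Quotient.mk (planeTreeSetoid m) t = T}.ncard * k := by
  have : {u : LabelledTree m × Fin k | Quotient.mk (planeTreeSetoid m) u.1 = T} =
      {t : LabelledTree m | Quotient.mk (planeTreeSetoid m) t = T} ×ˢ Set.univ := by
    ext; simp
  rw [this, Set.ncard_prod, Set.ncard_univ, Nat.card_fin]

/-- Double counting of labelled trees over `T` with a marked oriented edge. The symmetries of `T`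
are thereby accounted for without being mentioned. -/
theorem ncard_forgetRoot (T : PlaneTree m) :
    (2 * m).factorial * (PlantedTree.forgetRoot ⁻¹' {T}).ncard =
      {t : LabelledTree m | Quotient.mk (planeTreeSetoid m) t = T}.ncard * (2 * m) := by
  rw [← ncard_labelled_prod]
  exact (card_mem_quotient_eq_mul (plantedTreeSetoid m) _ card_plantedTree_class
    (PlantedTree.forgetRoot ⁻¹' {T})).symm.trans (Nat.card_coe_set_eq _)

variable {P : Equiv.Perm (Fin (2 * (e + m))) → Prop}

/-- Labelled decorations with a root on the tree are counted by classes and by their rooted trees;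
the outcome is free of `τ`. -/
theorem ncard_rootedOnTree {c : ℕ}
    (hc : ∀ t, Nat.card {x : Decoration e m // x.tree = t ∧ P x.map.face} = c)
    {A : Set (RootedOnTree e m)}
    (hA : ∀ p, Quotient.mk (rootedOnTreeSetoid e m) p ∈ A ↔ P p.1.map.face) (τ : PlantedTree m) :
    ((2 * (e + m)).factorial * (2 * m).factorial) * (A ∩ RootedOnTree.tree ⁻¹' {τ}).ncard =
      c * (2 * m).factorial := by
  rw [← ncard_labelled_planted τ, ← card_decoration_prod hc, ncard_labelled_planted τ]
  refine (card_mem_quotient_eq_mul (rootedOnTreeSetoid e m) _ card_rootedOnTree_class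
    (A ∩ RootedOnTree.tree ⁻¹' {τ})).symm.trans ?_
  exact Nat.card_congr (Equiv.subtypeEquivRight fun p => and_congr (hA p) Iff.rfl)

theorem ncard_treeDecorated {c : ℕ}
    (hc : ∀ t, Nat.card {x : Decoration e m // x.tree = t ∧ P x.map.face} = c)
    {A : Set (TreeDecoratedMap e m)}
    (hA : ∀ p, Quotient.mk (treeDecoratedSetoid e m) p ∈ A ↔ P p.1.map.face) (T : PlaneTree m) :
    ((2 * (e + m)).factorial * (2 * m).factorial) * (A ∩ TreeDecoratedMap.tree ⁻¹' {T}).ncard =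
      c * ({t : LabelledTree m | Quotient.mk (planeTreeSetoid m) t = T}.ncard *
        (2 * (e + m))) := by
  rw [← ncard_labelled_prod, ← card_decoration_prod hc]
  refine (card_mem_quotient_eq_mul (treeDecoratedSetoid e m) _ card_treeDecorated_class
    (A ∩ TreeDecoratedMap.tree ⁻¹' {T})).symm.trans ?_
  exact Nat.card_congr (Equiv.subtypeEquivRight fun p => and_congr (hA p) Iff.rfl)

open ProbabilityTheory

theorem map_tree_uniformOn_rootedOnTree (hm : 0 < m) {A : Set (RootedOnTree e m)}
    (hA : ∀ p, Quotient.mk (rootedOnTreeSetoid e m) p ∈ A ↔ P p.1.map.face) (hne : A.Nonempty) :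
    (uniformOn A).map RootedOnTree.tree = uniformOn (Set.univ : Set (PlantedTree m)) := by
  obtain ⟨c, hc⟩ := exists_card_decoration_eq hm P
  -- The target becomes an image under the identity, whose fibres are singletons.
  rw [← MeasureTheory.Measure.map_id (μ := uniformOn (Set.univ : Set (PlantedTree m)))]
  refine map_uniformOn_eq_map_uniformOn hne
    (mul_ne_zero (2 * (e + m)).factorial_ne_zero (2 * m).factorial_ne_zero)
    (L := c * (2 * m).factorial) fun τ => ?_
  rw [ncard_rootedOnTree hc hA]
  simp

theorem map_tree_uniformOn_treeDecorated (hm : 0 < m) {A : Set (TreeDecoratedMap e m)}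
    (hA : ∀ p, Quotient.mk (treeDecoratedSetoid e m) p ∈ A ↔ P p.1.map.face)
    (hne : A.Nonempty) :
    (uniformOn A).map TreeDecoratedMap.tree =
      (uniformOn (Set.univ : Set (PlantedTree m))).map PlantedTree.forgetRoot := by
  obtain ⟨c, hc⟩ := exists_card_decoration_eq hm P
  -- The extra `2 * m` in `K` matches the choices of tree root in `ncard_forgetRoot`, and `2 * (e +
  -- m)` in `L` the choices of map root.
  refine map_uniformOn_eq_map_uniformOn hne (K := 2 * m *
    ((2 * (e + m)).factorial * (2 * m).factorial)) (mul_ne_zero (by omega)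
    (mul_ne_zero (2 * (e + m)).factorial_ne_zero (2 * m).factorial_ne_zero))
    (L := c * (2 * (e + m)) * (2 * m).factorial) fun T => ?_
  have hT := ncard_forgetRoot T
  rw [mul_assoc (2 * m), ncard_treeDecorated hc hA, Set.univ_inter, mul_assoc _ _ (Set.ncard _),
    hT]
  ring

end Counting

/-! ### Existence of decorated maps, and conclusion -/

theorem nonempty_decoration (e : ℕ) {m : ℕ} (hm : 0 < m) : Nonempty (Decoration e m) := by
  -- The witness is a star inside a larger star; `star N` has `N + 1` edges, so `m` is replaced by
  -- its predecessor.
  obtain ⟨m, rfl⟩ := Nat.exists_eq_succ_of_ne_zero hm.ne'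
  let E (N : ℕ) : Fin (N + 1) × Bool ≃ Fin (2 * (N + 1)) :=
    Fintype.equivFinOfCardEq (by simp [mul_comm])
  exact ⟨{ map := (PlanarMap.star (e + m)).relabel (E (e + m))
           tree := ⟨(PlanarMap.star m).relabel (E m), (PlanarMap.isTree_star m).relabel _⟩
           emb := ((E m).symm.toEmbedding.trans ((Fin.castLEEmb (Nat.succ_le_succ
             (Nat.le_add_left m e))).prodMap (.refl Bool))).trans (E (e + m)).toEmbedding
           isSubmap := (PlanarMap.isSubmap_star (Nat.le_add_left m e)).isIso
             (PlanarMap.isIso_relabel _ _) (PlanarMap.isIso_relabel _ _) (by simp) }⟩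

theorem mainTheorem5 (e m : ℕ) (hm : 0 < m) :
    -- general maps with `e + m` edges
    (Nonempty (RootedOnTree e m) ∧
      (ProbabilityTheory.uniformOn (Set.univ : Set (RootedOnTree e m))).map RootedOnTree.tree =
        ProbabilityTheory.uniformOn (Set.univ : Set (PlantedTree m)) ∧
      (ProbabilityTheory.uniformOn (Set.univ : Set (TreeDecoratedMap e m))).map
          TreeDecoratedMap.tree =
        (ProbabilityTheory.uniformOn (Set.univ : Set (PlantedTree m))).map
          PlantedTree.forgetRoot) ∧
    -- `q`-angulations with `e + m` edges
    (∀ q : ℕ,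
      ({x : RootedOnTree e m | x.IsAngulation q}.Nonempty →
        (ProbabilityTheory.uniformOn {x : RootedOnTree e m | x.IsAngulation q}).map
            RootedOnTree.tree =
          ProbabilityTheory.uniformOn (Set.univ : Set (PlantedTree m))) ∧
      ({x : TreeDecoratedMap e m | x.IsAngulation q}.Nonempty →
        (ProbabilityTheory.uniformOn {x : TreeDecoratedMap e m | x.IsAngulation q}).map
            TreeDecoratedMap.tree =
          (ProbabilityTheory.uniformOn (Set.univ : Set (PlantedTree m))).map
            PlantedTree.forgetRoot)) := by
  obtain ⟨x⟩ := nonempty_decoration e hm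
  have hR : Nonempty (RootedOnTree e m) := ⟨Quotient.mk _ (x, ⟨0, by omega⟩)⟩
  have hD : Nonempty (TreeDecoratedMap e m) := ⟨Quotient.mk _ (x, ⟨0, by omega⟩)⟩
  -- Being a `q`-angulation depends on the face permutation alone.
  let Q (q : ℕ) (φ : Equiv.Perm (Fin (2 * (e + m)))) : Prop :=
    ∀ d, Nat.card {d' // φ.SameCycle d d'} = q
  exact ⟨⟨hR,
      map_tree_uniformOn_rootedOnTree (P := fun _ => True) hm (fun _ => iff_of_true trivial trivial)
        Set.univ_nonempty,
      map_tree_uniformOn_treeDecorated (P := fun _ => True) hm (fun _ => iff_of_true trivial trivial)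
        Set.univ_nonempty⟩,
    fun q => ⟨map_tree_uniformOn_rootedOnTree (P := Q q) hm fun _ => Iff.rfl,
      map_tree_uniformOn_treeDecorated (P := Q q) hm fun _ => Iff.rfl⟩⟩
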